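/- Let $\mathit{Atm}_0$ be a finite set of atomic propositions and $\mathit{Val}$ a finite set of output values. The language $\mathcal{L}^{\mathit{dyn}}$ is given by the grammar $$\varphi ::= p \mid \mathsf{t}(x) \mid \neg\varphi \mid \varphi\wedge\varphi \mid \Box_{\mathtt I}\varphi \mid \Box_{\mathtt F}\varphi \mid [\varphi]\varphi \qquad (p\in \mathit{Atm}_0,\ x\in \mathit{Val}),$$ with the other Boolean connectives defined as usual. **Semantics.** A multi-classifier model (MCM) is a pair $\Gamma=(S,\Phi)$ with $S\subseteq 2^{\mathit{Atm}_0}$ and $\Phi\subseteq \mathit{Val}^S$. For $s\in S$ and $f\in\Phi$: $(\Gamma,s,f)\models p$ iff $p\in s$; $(\Gamma,s,f)\models \mathsf{t}(x)$ iff $f(s)=x$; $\neg$ and $\wedge$ are classical; $(\Gamma,s,f)\models\Box_{\mathtt I}\varphi$ iff $(\Gamma,s',f)\models\varphi$ for all $s'\in S$; $(\Gamma,s,f)\models\Box_{\mathtt F}\varphi$ iff $(\Gamma,s,f')\models\varphi$ for all $f'\in\Phi$; and $(\Gamma,s,f)\models[\varphi]\psi$ iff $(\Gamma,s,f)\models\Box_{\mathtt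 I}\varphi$ implies $(\Gamma^\varphi,s,f)\models\psi$, where $\Gamma^\varphi=(S,\{f'\in\Phi : (\Gamma,s',f')\models\varphi\text{ for all }s'\in S\})$. A formula is valid relative to the class $\mathbf{MCM}$ of all MCMs if it is true at every $(\Gamma,s,f)$ with $\Gamma=(S,\Phi)$ an MCM, $s\in S$, $f\in\Phi$. **Proof system.** The logic $\mathsf{D\text{-}PLC}$ is the smallest set of $\mathcal{L}^{\mathit{dyn}}$-formulas that contains all instances of classical propositional tautologies and all instances (for all $\mathcal{L}^{\mathit{dyn}}$-formulas $\varphi,\psi,\psi_1,\psi_2$, all $p\in \mathit{Atm}_0$, $x,y\in \mathit{Val}$, $X\subseteq \mathit{Atm}_0$ and $\blacksquare\in\{\Box_{\mathtt I},\Box_{\mathtt F}\}$) of - $(\blacksquare\varphi\wedge\blacksquare(\varphi\to\psi))\to\blacksquare\psi$, $\ \blacksquare\varphi\to\varphi$, $\ \blacksquare\varphi\to\blacksquare\blacksquare\varphi$, $\ \neg\blacksquare\varphi\to\blacksquare\neg\blacksquare\varphi$, $\ \Box_{\mathtt F}\Box_{\mathtt I}\varphi\leftrightarrow\Box_{\mathtt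 I}\Box_{\mathtt F}\varphi$; - $\bigvee_{x\in \mathit{Val}}\mathsf{t}(x)$, $\ \mathsf{t}(x)\to\neg\mathsf{t}(y)$ if $x\ne y$, $\ (c_X\wedge\mathsf{t}(x))\to\Box_{\mathtt I}(c_X\to\mathsf{t}(x))$ with $c_X=\bigwedge_{p\in X}p\wedge\bigwedge_{p\in \mathit{Atm}_0\setminus X}\neg p$, $\ p\to\Box_{\mathtt F}p$, $\ \neg p\to\Box_{\mathtt F}\neg p$; - $[\varphi]p\leftrightarrow(\Box_{\mathtt I}\varphi\to p)$, $\ [\varphi]\mathsf{t}(x)\leftrightarrow(\Box_{\mathtt I}\varphi\to\mathsf{t}(x))$, $\ [\varphi]\neg\psi\leftrightarrow(\Box_{\mathtt I}\varphi\to\neg[\varphi]\psi)$, $\ [\varphi](\psi_1\wedge\psi_2)\leftrightarrow([\varphi]\psi_1\wedge[\varphi]\psi_2)$, $\ [\varphi]\Box_{\mathtt I}\psi\leftrightarrow(\Box_{\mathtt I}\varphi\to\Box_{\mathtt I}[\varphi]\psi)$, $\ [\varphi]\Box_{\mathtt F}\psi\leftrightarrow(\Box_{\mathtt I}\varphi\to\Box_{\mathtt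 F}[\varphi]\psi)$; and that is closed under modus ponens, necessitation (from $\varphi$ infer $\blacksquare\varphi$), and replacement of equivalents (from $\varphi_1\leftrightarrow\varphi_2$ infer $\psi\leftrightarrow\psi'$ whenever $\psi'$ results from $\psi$ by replacing some occurrences of $\varphi_1$ by $\varphi_2$). **Theorem.** $\mathsf{D\text{-}PLC}$ is sound and complete relative to $\mathbf{MCM}$: a formula of $\mathcal{L}^{\mathit{dyn}}$ belongs to $\mathsf{D\text{-}PLC}$ if and only if it is valid relative to $\mathbf{MCM}$. -/

import Mathlib

namespace DPLC

universe u v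

/-- Formulas of the dynamic language over input atoms `Atm₀` and output values `Val`:
`p`, `t(x)`, `¬ φ`, `φ ∧ ψ`, `□_I φ`, `□_F φ`, `[φ] ψ`. -/
inductive Form (Atm₀ : Type u) (Val : Type v) : Type (max u v)
  | atom (p : Atm₀) : Form Atm₀ Val
  | dec (x : Val) : Form Atm₀ Val
  | neg (φ : Form Atm₀ Val) : Form Atm₀ Val
  | and (φ ψ : Form Atm₀ Val) : Form Atm₀ Val
  | boxI (φ : Form Atm₀ Val) : Form Atm₀ Val
  | boxF (φ : Form Atm₀ Val) : Form Atm₀ Val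
  | upd (φ ψ : Form Atm₀ Val) : Form Atm₀ Val

/-- The two dimensions of the static modalities: input instances and classifiers. -/
inductive Dim : Type
  | I
  | F

namespace Form

variable {Atm₀ : Type u} {Val : Type v}

/-- `φ ∨ ψ`. -/
def or (φ ψ : Form Atm₀ Val) : Form Atm₀ Val := neg (and (neg φ) (neg ψ))

/-- `φ → ψ`. -/
def imp (φ ψ : Form Atm₀ Val) : Form Atm₀ Val := neg (and φ (neg ψ))

/-- `φ ↔ ψ`. -/
def iff (φ ψ : Form Atm₀ Val) : Form Atm₀ Val := and (imp φ ψ) (imp ψ φ)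

/-- `■ φ` with `■ ∈ {□_I, □_F}`. -/
def box : Dim → Form Atm₀ Val → Form Atm₀ Val
  | Dim.I, φ => boxI φ
  | Dim.F, φ => boxF φ

/-- Falsum, written with an arbitrary formula `χ`, as the language has no constants. -/
def falsum (χ : Form Atm₀ Val) : Form Atm₀ Val := and χ (neg χ)

/-- Verum, written with an arbitrary formula `χ`. -/
def verum (χ : Form Atm₀ Val) : Form Atm₀ Val := neg (falsum χ)

/-- Finite conjunction; the empty one is `verum χ`. -/
def bigAnd (χ : Form Atm₀ Val) (l : List (Form Atm₀ Val)) : Form Atm₀ Val :=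
  l.foldr and (verum χ)

/-- Finite disjunction; the empty one is `falsum χ`. -/
def bigOr (χ : Form Atm₀ Val) (l : List (Form Atm₀ Val)) : Form Atm₀ Val :=
  l.foldr or (falsum χ)

open Classical in
/-- `cn_{X,Y} = ⋀_{p ∈ X} p ∧ ⋀_{p ∈ Y \ X} ¬ p` for finite sets `X`, `Y` of input atoms. -/
noncomputable def conj (χ : Form Atm₀ Val) (X Y : Finset Atm₀) : Form Atm₀ Val :=
  and (bigAnd χ (X.toList.map atom)) (bigAnd χ ((Y \ X).toList.map (fun p => neg (atom p))))

/-- Instances of classical propositional tautologies: true under every assignment of truth values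
to formulas that respects `¬` and `∧`. -/
def IsTautology (φ : Form Atm₀ Val) : Prop :=
  ∀ val : Form Atm₀ Val → Prop,
    (∀ ψ, val (neg ψ) ↔ ¬ val ψ) →
    (∀ ψ χ, val (and ψ χ) ↔ (val ψ ∧ val χ)) →
    val φ

/-- `Replace α β ψ ψ'`: the formula `ψ'` results from `ψ` by replacing some (possibly none, possibly
all) occurrences of `α` as a subformula by `β`. -/
inductive Replace (α β : Form Atm₀ Val) : Form Atm₀ Val → Form Atm₀ Val → Prop
  | here : Replace α β α β
  | refl (ψ : Form Atm₀ Val) : Replace α β ψ ψ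
  | neg {ψ ψ' : Form Atm₀ Val} : Replace α β ψ ψ' → Replace α β (neg ψ) (neg ψ')
  | and {ψ ψ' χ χ' : Form Atm₀ Val} : Replace α β ψ ψ' → Replace α β χ χ' →
      Replace α β (and ψ χ) (and ψ' χ')
  | boxI {ψ ψ' : Form Atm₀ Val} : Replace α β ψ ψ' → Replace α β (boxI ψ) (boxI ψ')
  | boxF {ψ ψ' : Form Atm₀ Val} : Replace α β ψ ψ' → Replace α β (boxF ψ) (boxF ψ')
  | upd {ψ ψ' χ χ' : Form Atm₀ Val} : Replace α β ψ ψ' → Replace α β χ χ' →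
      Replace α β (upd ψ χ) (upd ψ' χ')

end Form

/-- Multi-classifier models: a set `S` of input instances (each given by the set of atoms true in
it) and a set `Φ` of classifiers, which are functions from `S` to `Val`. -/
structure MCM (Atm₀ : Type u) (Val : Type v) where
  S : Set (Set Atm₀)
  Φ : Set (S → Val)

section Semantics

variable {Atm₀ : Type u} {Val : Type v}

/-- The model with the same inputs that keeps only the classifiers in `P`. -/
def MCM.keep (Γ : MCM Atm₀ Val) (P : Set (Γ.S → Val)) : MCM Atm₀ Val :=
  { S := Γ.S, Φ := {f | f ∈ Γ.Φ ∧ f ∈ P} }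

/-- `(Γ, s, f) ⊨ φ`. It is used for `f ∈ Γ.Φ` only. -/
def Sat : Form Atm₀ Val → (Γ : MCM Atm₀ Val) → Γ.S → (Γ.S → Val) → Prop
  | Form.atom p, _, s, _ => p ∈ s.1
  | Form.dec x, _, s, f => f s = x
  | Form.neg φ, Γ, s, f => ¬ Sat φ Γ s f
  | Form.and φ ψ, Γ, s, f => Sat φ Γ s f ∧ Sat ψ Γ s f
  | Form.boxI φ, Γ, _, f => ∀ s' : Γ.S, Sat φ Γ s' f
  | Form.boxF φ, Γ, s, _ => ∀ f' ∈ Γ.Φ, Sat φ Γ s f'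
  | Form.upd φ ψ, Γ, s, f =>
      (∀ s' : Γ.S, Sat φ Γ s' f) →
        Sat ψ (Γ.keep {f' | ∀ s' : Γ.S, Sat φ Γ s' f'}) s f

/-- `φ` is true at some pointed MCM. -/
def Satisfiable (φ : Form Atm₀ Val) : Prop :=
  ∃ (Γ : MCM Atm₀ Val) (s : Γ.S) (f : Γ.S → Val), f ∈ Γ.Φ ∧ Sat φ Γ s f

/-- `φ` is valid relative to the class of all MCMs. -/
def Valid (φ : Form Atm₀ Val) : Prop := ¬ Satisfiable (Form.neg φ)

end Semantics

section ProofSystem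

open Form

variable {Atm₀ : Type u} {Val : Type v}

/-- The modal axioms of the static logic, as schemas over the dynamic language. -/
inductive StaticAxiom [Fintype Atm₀] [Fintype Val] : Form Atm₀ Val → Prop
  | K (m : Dim) (φ ψ : Form Atm₀ Val) :
      StaticAxiom (imp (and (box m φ) (box m (imp φ ψ))) (box m ψ))
  | T (m : Dim) (φ : Form Atm₀ Val) : StaticAxiom (imp (box m φ) φ)
  | four (m : Dim) (φ : Form Atm₀ Val) : StaticAxiom (imp (box m φ) (box m (box m φ)))
  | five (m : Dim) (φ : Form Atm₀ Val) :
      StaticAxiom (imp (neg (box m φ)) (box m (neg (box m φ))))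
  | comm (φ : Form Atm₀ Val) : StaticAxiom (iff (boxF (boxI φ)) (boxI (boxF φ)))
  | atLeast (χ : Form Atm₀ Val) :
      StaticAxiom (bigOr χ ((Finset.univ : Finset Val).toList.map dec))
  | atMost (x y : Val) : x ≠ y → StaticAxiom (imp (dec x) (neg (dec y)))
  | funct (χ : Form Atm₀ Val) (X : Finset Atm₀) (x : Val) :
      StaticAxiom (imp (and (conj χ X Finset.univ) (dec x))
        (boxI (imp (conj χ X Finset.univ) (dec x))))
  | indepPos (p : Atm₀) : StaticAxiom (imp (atom p) (boxF (atom p)))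
  | indepNeg (p : Atm₀) : StaticAxiom (imp (neg (atom p)) (boxF (neg (atom p))))

/-- The reduction axioms for the update operators `[φ]`. -/
inductive ReductionAxiom : Form Atm₀ Val → Prop
  | atom (φ : Form Atm₀ Val) (p : Atm₀) :
      ReductionAxiom (iff (upd φ (atom p)) (imp (boxI φ) (atom p)))
  | dec (φ : Form Atm₀ Val) (x : Val) :
      ReductionAxiom (iff (upd φ (dec x)) (imp (boxI φ) (dec x)))
  | neg (φ ψ : Form Atm₀ Val) :
      ReductionAxiom (iff (upd φ (neg ψ)) (imp (boxI φ) (neg (upd φ ψ))))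
  | and (φ ψ₁ ψ₂ : Form Atm₀ Val) :
      ReductionAxiom (iff (upd φ (and ψ₁ ψ₂)) (and (upd φ ψ₁) (upd φ ψ₂)))
  | boxI (φ ψ : Form Atm₀ Val) :
      ReductionAxiom (iff (upd φ (boxI ψ)) (imp (boxI φ) (boxI (upd φ ψ))))
  | boxF (φ ψ : Form Atm₀ Val) :
      ReductionAxiom (iff (upd φ (boxF ψ)) (imp (boxI φ) (boxF (upd φ ψ))))

/-- Theoremhood in D-PLC: classical propositional logic, the static axioms with necessitation,
the reduction axioms, and the rule of replacement of equivalents. -/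
inductive Provable [Fintype Atm₀] [Fintype Val] : Form Atm₀ Val → Prop
  | taut {φ : Form Atm₀ Val} : IsTautology φ → Provable φ
  | static {φ : Form Atm₀ Val} : StaticAxiom φ → Provable φ
  | reduction {φ : Form Atm₀ Val} : ReductionAxiom φ → Provable φ
  | mp {φ ψ : Form Atm₀ Val} : Provable (imp φ ψ) → Provable φ → Provable ψ
  | nec (m : Dim) {φ : Form Atm₀ Val} : Provable φ → Provable (box m φ)
  | re {φ₁ φ₂ ψ ψ' : Form Atm₀ Val} :
      Provable (iff φ₁ φ₂) → Replace φ₁ φ₂ ψ ψ' → Provable (iff ψ ψ')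

end ProofSystem

end DPLC

/-! Soundness is an induction on derivations; the delicate rule is replacement, since equivalents
must also be exchanged inside updated models.

For completeness, the reduction axioms push an update through every static connective, so
eliminating innermost updates first makes every formula provably equivalent to a static one
(`exists_isStatic_iff`). A static non-theorem is missing from some maximal theory. The two boxes
give commuting equivalence relations on such theories (`Acc.commute`), so a component is exhausted
by an F-step followed by an I-step. Atoms are constant along F-steps, and inside an I-class the
atoms fix the decision; hence theories yield inputs and I-classes yield classifiers. Truth is
compared with membership for every theory `w` and every classifier representing `w`
(`IsStatic.sat_canonical`), so distinct theories may share an input and a classifier. -/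

namespace DPLC

section BooleanValuations

variable {Atm₀ : Type*} {Val : Type*}

/-- A truth assignment to formulas that respects `¬` and `∧`. -/
structure IsBoolean (val : Form Atm₀ Val → Prop) : Prop where
  neg : ∀ ψ, val (.neg ψ) ↔ ¬ val ψ
  and : ∀ ψ χ, val (.and ψ χ) ↔ (val ψ ∧ val χ)

namespace IsBoolean

variable {val : Form Atm₀ Val → Prop} (h : IsBoolean val)

include h

theorem or (φ ψ : Form Atm₀ Val) : val (.or φ ψ) ↔ (val φ ∨ val ψ) := by
  simp only [Form.or, h.neg, h.and]; tauto

theorem imp (φ ψ : Form Atm₀ Val) : val (.imp φ ψ) ↔ (val φ → val ψ) := by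
  simp only [Form.imp, h.neg, h.and]; tauto

theorem iff (φ ψ : Form Atm₀ Val) : val (.iff φ ψ) ↔ (val φ ↔ val ψ) := by
  simp only [Form.iff, h.imp, h.and]; tauto

theorem not_falsum (χ : Form Atm₀ Val) : ¬ val (.falsum χ) := by
  simp only [Form.falsum, h.neg, h.and]; tauto

theorem bigAnd (χ : Form Atm₀ Val) (l : List (Form Atm₀ Val)) :
    val (.bigAnd χ l) ↔ ∀ φ ∈ l, val φ := by
  induction l with
  | nil => simpa [Form.bigAnd, Form.verum, h.neg] using h.not_falsum χ
  | cons φ l ih =>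
    have : Form.bigAnd χ (φ :: l) = .and φ (.bigAnd χ l) := rfl
    simp [this, h.and, ih]

theorem bigOr (χ : Form Atm₀ Val) (l : List (Form Atm₀ Val)) :
    val (.bigOr χ l) ↔ ∃ φ ∈ l, val φ := by
  induction l with
  | nil => simpa [Form.bigOr] using h.not_falsum χ
  | cons φ l ih =>
    have : Form.bigOr χ (φ :: l) = .or φ (.bigOr χ l) := rfl
    simp [this, h.or, ih]

theorem conj [Fintype Atm₀] (χ : Form Atm₀ Val) (X : Finset Atm₀) :
    val (.conj χ X Finset.univ) ↔ ∀ p, val (.atom p) ↔ p ∈ X := by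
  simp only [Form.conj, h.and, h.bigAnd, List.mem_map, Finset.mem_toList, forall_exists_index,
    and_imp, forall_apply_eq_imp_iff₂, Finset.mem_sdiff, Finset.mem_univ, true_and, h.neg]
  exact ⟨fun ⟨h₁, h₂⟩ p => ⟨fun hp => by_contra fun hX => h₂ p hX hp, h₁ p⟩,
    fun h' => ⟨fun p => (h' p).2, fun p hX hp => hX ((h' p).1 hp)⟩⟩

end IsBoolean

end BooleanValuations

/-! ### The update-free fragment -/

section StaticFormulas

variable {Atm₀ : Type*} {Val : Type*}

/-- Formulas without update operators. -/
inductive IsStatic : Form Atm₀ Val → Prop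
  | atom (p) : IsStatic (.atom p)
  | dec (x) : IsStatic (.dec x)
  | neg {φ} : IsStatic φ → IsStatic (.neg φ)
  | and {φ ψ} : IsStatic φ → IsStatic ψ → IsStatic (.and φ ψ)
  | boxI {φ} : IsStatic φ → IsStatic (.boxI φ)
  | boxF {φ} : IsStatic φ → IsStatic (.boxF φ)

theorem IsStatic.imp {φ ψ : Form Atm₀ Val} (hφ : IsStatic φ) (hψ : IsStatic ψ) :
    IsStatic (.imp φ ψ) :=
  .neg (.and hφ (.neg hψ))

end StaticFormulas

/-! ### Soundness -/

section Soundness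

variable {Atm₀ : Type*} {Val : Type*}

theorem valid_iff (φ : Form Atm₀ Val) :
    Valid φ ↔ ∀ (Γ : MCM Atm₀ Val) (s : Γ.S), ∀ f ∈ Γ.Φ, Sat φ Γ s f := by
  simp [Valid, Satisfiable, Sat]

theorem isBoolean_sat (Γ : MCM Atm₀ Val) (s : Γ.S) (f : Γ.S → Val) :
    IsBoolean fun φ => Sat φ Γ s f :=
  ⟨fun _ => Iff.rfl, fun _ _ => Iff.rfl⟩

theorem sat_imp (φ ψ : Form Atm₀ Val) (Γ : MCM Atm₀ Val) (s : Γ.S) (f : Γ.S → Val) :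
    Sat (.imp φ ψ) Γ s f ↔ (Sat φ Γ s f → Sat ψ Γ s f) :=
  (isBoolean_sat Γ s f).imp φ ψ

theorem sat_iff (φ ψ : Form Atm₀ Val) (Γ : MCM Atm₀ Val) (s : Γ.S) (f : Γ.S → Val) :
    Sat (.iff φ ψ) Γ s f ↔ (Sat φ Γ s f ↔ Sat ψ Γ s f) :=
  (isBoolean_sat Γ s f).iff φ ψ

theorem StaticAxiom.valid [Fintype Atm₀] [Fintype Val] {φ : Form Atm₀ Val}
    (h : StaticAxiom φ) : Valid φ := by
  rw [valid_iff]
  intro Γ s f hf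
  cases h with
  | K m φ ψ =>
    rw [sat_imp]
    rintro ⟨h₁, h₂⟩
    cases m with
    | I => exact fun s' => (sat_imp _ _ _ _ _).1 (h₂ s') (h₁ s')
    | F => exact fun f' hf' => (sat_imp _ _ _ _ _).1 (h₂ f' hf') (h₁ f' hf')
  | T m φ =>
    rw [sat_imp]
    cases m with
    | I => exact fun h => h s
    | F => exact fun h => h f hf
  | four m φ =>
    rw [sat_imp]
    cases m with
    | I => exact fun h _ => h
    | F => exact fun h _ _ => h
  | five m φ =>
    rw [sat_imp]
    cases m with
    | I => exact fun h _ => h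
    | F => exact fun h _ _ => h
  | comm φ =>
    rw [sat_iff]
    exact ⟨fun h s' f' hf' => h f' hf' s', fun h f' hf' s' => h s' f' hf'⟩
  | atLeast χ =>
    refine ((isBoolean_sat Γ s f).bigOr χ _).2 ⟨.dec (f s), ?_, rfl⟩
    simp
  | atMost x y hxy =>
    rw [sat_imp]
    rintro rfl h
    exact hxy h
  | funct χ X x =>
    rw [sat_imp]
    rintro ⟨hX, hx⟩ s'
    rw [sat_imp]
    intro hX'
    have h₁ := ((isBoolean_sat Γ s f).conj χ X).1 hX
    have h₂ := ((isBoolean_sat Γ s' f).conj χ X).1 hX'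
    have hs : s' = s := Subtype.ext (Set.ext fun p => (h₂ p).trans (h₁ p).symm)
    exact hs ▸ hx
  | indepPos p =>
    rw [sat_imp]
    exact fun h _ _ => h
  | indepNeg p =>
    rw [sat_imp]
    exact fun h _ _ => h

theorem ReductionAxiom.valid {φ : Form Atm₀ Val} (h : ReductionAxiom φ) : Valid φ := by
  rw [valid_iff]
  intro Γ s f hf
  cases h <;> simp only [sat_iff, sat_imp, Sat]
  case neg => exact ⟨fun h h₁ h₂ => h h₁ (h₂ h₁), fun h h₁ h₂ => h h₁ fun _ => h₂⟩
  case and => exact ⟨fun h => ⟨fun h₁ => (h h₁).1, fun h₁ => (h h₁).2⟩,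
    fun h h₁ => ⟨h.1 h₁, h.2 h₁⟩⟩
  case boxI => exact ⟨fun h h₁ s' _ => h h₁ s', fun h h₁ s' => h h₁ s' h₁⟩
  case boxF => exact ⟨fun h h₁ f' hf' h₂ => h h₁ f' ⟨hf', h₂⟩,
    fun h h₁ f' hf' => h h₁ f' hf'.1 hf'.2⟩

/-- The model varies in the induction because an update evaluates its second argument in a
restricted model. Validity speaks only of classifiers of the model, so `f ∈ Γ.Φ` has to be carried
along. -/
theorem Form.Replace.sat_iff {α β ψ ψ' : Form Atm₀ Val} (h : Form.Replace α β ψ ψ')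
    (hαβ : Valid (.iff α β)) (Γ : MCM Atm₀ Val) (s : Γ.S) (f : Γ.S → Val) (hf : f ∈ Γ.Φ) :
    Sat ψ Γ s f ↔ Sat ψ' Γ s f := by
  induction h generalizing Γ with
  | here => exact (DPLC.sat_iff _ _ _ _ _).1 ((valid_iff _).1 hαβ Γ s f hf)
  | refl ψ => exact Iff.rfl
  | neg _ ih => exact not_congr (ih Γ s f hf)
  | and _ _ ih₁ ih₂ => exact and_congr (ih₁ Γ s f hf) (ih₂ Γ s f hf)
  | boxI _ ih => exact forall_congr' fun s' => ih Γ s' f hf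
  | boxF _ ih => exact forall₂_congr fun f' hf' => ih Γ s f' hf'
  | @upd ψ ψ' χ χ' _ _ ih₁ ih₂ =>
    have hΦ : ({f' | f' ∈ Γ.Φ ∧ ∀ s' : Γ.S, Sat ψ Γ s' f'} : Set (Γ.S → Val)) =
        {f' | f' ∈ Γ.Φ ∧ ∀ s' : Γ.S, Sat ψ' Γ s' f'} :=
      Set.ext fun f' => and_congr_right fun hf' => forall_congr' fun s' => ih₁ Γ s' f' hf'
    have hsat : (∀ s' : Γ.S, Sat ψ Γ s' f) ↔ ∀ s' : Γ.S, Sat ψ' Γ s' f :=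
      forall_congr' fun s' => ih₁ Γ s' f hf
    refine imp_congr_ctx hsat fun h => ?_
    refine (ih₂ (Γ.keep {f' | ∀ s' : Γ.S, Sat ψ Γ s' f'}) s f ⟨hf, hsat.2 h⟩).trans ?_
    -- Both restrictions keep the same classifiers; holding `Γ.S` fixed lets `s` and `f` keep their
    -- types.
    exact Iff.of_eq (congrArg (fun Ψ => Sat χ' ⟨Γ.S, Ψ⟩ s f) hΦ)

theorem Provable.valid [Fintype Atm₀] [Fintype Val] {φ : Form Atm₀ Val}
    (h : Provable φ) : Valid φ := by
  induction h with
  | taut h =>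
    exact (valid_iff _).2 fun Γ s f _ =>
      h (Sat · Γ s f) (isBoolean_sat Γ s f).neg (isBoolean_sat Γ s f).and
  | static h => exact h.valid
  | reduction h => exact h.valid
  | mp _ _ ih₁ ih₂ =>
    rw [valid_iff] at *
    exact fun Γ s f hf => (sat_imp _ _ _ _ _).1 (ih₁ Γ s f hf) (ih₂ Γ s f hf)
  | nec m _ ih =>
    rw [valid_iff] at *
    intro Γ s f hf
    cases m with
    | I => exact fun s' => ih Γ s' f hf
    | F => exact fun f' hf' => ih Γ s f' hf'
  | re _ hr ih =>
    exact (valid_iff _).2 fun Γ s f hf => (sat_iff _ _ _ _ _).2 (hr.sat_iff ih Γ s f hf)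

end Soundness

/-! ### Derivability and maximal theories -/

section Theories

variable {Atm₀ : Type*} {Val : Type*} [Fintype Atm₀] [Fintype Val]

theorem Provable.of_boolean {φ : Form Atm₀ Val} (h : ∀ val, IsBoolean val → val φ) :
    Provable φ :=
  .taut fun val hn ha => h val ⟨hn, ha⟩

/-- Derivability from a set of hypotheses, using modus ponens and all theorems. -/
inductive Derivable (A : Set (Form Atm₀ Val)) : Form Atm₀ Val → Prop
  | thm {φ} : Provable φ → Derivable A φ
  | hyp {φ} : φ ∈ A → Derivable A φ
  | mp {φ ψ} : Derivable A (.imp φ ψ) → Derivable A φ → Derivable A ψ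

namespace Derivable

variable {A B : Set (Form Atm₀ Val)} {φ ψ χ : Form Atm₀ Val}

theorem mono (h : Derivable A φ) (hAB : A ⊆ B) : Derivable B φ := by
  induction h with
  | thm h => exact .thm h
  | hyp h => exact .hyp (hAB h)
  | mp _ _ ih₁ ih₂ => exact .mp ih₁ ih₂

theorem of_boolean (h : Derivable A φ) (hb : ∀ val, IsBoolean val → val φ → val ψ) :
    Derivable A ψ :=
  .mp (.thm (.of_boolean fun val hv => (hv.imp _ _).2 (hb val hv))) h

theorem of_boolean₂ (h₁ : Derivable A φ) (h₂ : Derivable A ψ)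
    (hb : ∀ val, IsBoolean val → val φ → val ψ → val χ) : Derivable A χ := by
  refine .mp (h₁.of_boolean (ψ := .imp ψ χ) fun val hv => ?_) h₂
  rw [hv.imp]
  exact hb val hv

theorem provable (h : Derivable ∅ φ) : Provable φ := by
  induction h with
  | thm h => exact h
  | hyp h => exact h.elim
  | mp _ _ ih₁ ih₂ => exact .mp ih₁ ih₂

theorem deduction (h : Derivable (insert ψ A) φ) : Derivable A (.imp ψ φ) := by
  induction h with
  | thm h => exact (Derivable.thm h).of_boolean fun val hv hφ => by simp [hv.imp, hφ]
  | @hyp χ h =>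
    rcases h with rfl | h
    · exact .thm (.of_boolean fun val hv => by simp [hv.imp])
    · exact (Derivable.hyp h).of_boolean fun val hv hφ => by simp [hv.imp, hφ]
  | mp _ _ ih₁ ih₂ =>
    refine ih₁.of_boolean₂ ih₂ fun val hv => ?_
    simp only [hv.imp]
    tauto

theorem exists_of_sUnion {c : Set (Set (Form Atm₀ Val))} (hc : IsChain (· ⊆ ·) c)
    (hne : c.Nonempty) (h : Derivable (⋃₀ c) φ) : ∃ A ∈ c, Derivable A φ := by
  induction h with
  | thm h => exact ⟨_, hne.some_mem, .thm h⟩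
  | hyp h =>
    obtain ⟨A, hA, h⟩ := h
    exact ⟨A, hA, .hyp h⟩
  | mp _ _ ih₁ ih₂ =>
    obtain ⟨A, hA, h₁⟩ := ih₁
    obtain ⟨B, hB, h₂⟩ := ih₂
    rcases hc.total hA hB with h | h
    · exact ⟨B, hB, .mp (h₁.mono h) h₂⟩
    · exact ⟨A, hA, .mp h₁ (h₂.mono h)⟩

/-- A derivation uses finitely many members of `B`, and a deductively closed `B` contains their
conjunction. -/
theorem exists_of_union (hB : ∀ φ, Derivable B φ → φ ∈ B) (h : Derivable (A ∪ B) φ) :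
    ∃ β ∈ B, Derivable A (.imp β φ) := by
  induction h with
  | @thm φ h =>
    exact ⟨φ, hB _ (.thm h), .thm (.of_boolean fun val hv => by simp [hv.imp])⟩
  | @hyp φ h =>
    rcases h with h | h
    -- No member of `B` is used here, so any theorem can serve as `β`.
    · exact ⟨.imp φ φ, hB _ (.thm (.of_boolean fun val hv => by simp [hv.imp])),
        (Derivable.hyp h).of_boolean fun val hv hφ => by simp [hv.imp, hφ]⟩
    · exact ⟨φ, h, .thm (.of_boolean fun val hv => by simp [hv.imp])⟩
  | mp _ _ ih₁ ih₂ =>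
    obtain ⟨β₁, hβ₁, h₁⟩ := ih₁
    obtain ⟨β₂, hβ₂, h₂⟩ := ih₂
    refine ⟨.and β₁ β₂, hB _ ((Derivable.hyp hβ₁).of_boolean₂ (.hyp hβ₂) fun val hv => ?_),
      h₁.of_boolean₂ h₂ fun val hv => ?_⟩
    · simp only [hv.and]
      tauto
    · simp only [hv.and, hv.imp]
      tauto

end Derivable

variable (Atm₀ Val) in
/-- Maximal consistent sets of formulas. -/
structure MaxTheory where
  carrier : Set (Form Atm₀ Val)
  closed : ∀ φ, Derivable carrier φ → φ ∈ carrier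
  neg_mem : ∀ φ, .neg φ ∈ carrier ↔ φ ∉ carrier

instance : Membership (Form Atm₀ Val) (MaxTheory Atm₀ Val) :=
  ⟨fun w φ => φ ∈ w.carrier⟩

/-- Zorn is applied to the sets not deriving `φ`, as the language has no constant for falsum. By
maximality and deduction every formula outside such a set implies `φ` over it, which gives closure
and completeness for negation. -/
theorem exists_maxTheory {A : Set (Form Atm₀ Val)} {φ : Form Atm₀ Val} (h : ¬ Derivable A φ) :
    ∃ w : MaxTheory Atm₀ Val, (∀ ψ ∈ A, ψ ∈ w) ∧ φ ∉ w := by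
  obtain ⟨M, hAM, hM⟩ := zorn_subset_nonempty {B | ¬ Derivable B φ}
    (fun c hc hchain hne => ⟨⋃₀ c, fun hd =>
      let ⟨B, hB, hd⟩ := hd.exists_of_sUnion hchain hne
      hc hB hd, fun _ => Set.subset_sUnion_of_mem⟩) A h
  have hMφ : ¬ Derivable M φ := hM.prop
  have hout : ∀ ψ, ψ ∉ M → Derivable M (.imp ψ φ) := fun ψ hψ => by
    by_contra hd
    have hins : ¬ Derivable (insert ψ M) φ := fun h' => hd h'.deduction
    exact hψ (hM.le_of_ge hins (Set.subset_insert ψ M) (Set.mem_insert ψ M))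
  refine ⟨⟨M, fun ψ hd => ?_, fun ψ => ⟨fun h₁ h₂ => ?_, fun h₁ => ?_⟩⟩, hAM,
    fun h' => hMφ (.hyp h')⟩
  · by_contra hψ
    exact hMφ (.mp (hout ψ hψ) hd)
  · exact hMφ ((Derivable.hyp h₁).of_boolean₂ (.hyp h₂) fun val hv h => by
      simp only [hv.neg] at h; tauto)
  · by_contra h₂
    refine hMφ ((hout _ h₁).of_boolean₂ (hout _ h₂) fun val hv => ?_)
    simp only [hv.imp, hv.neg]
    tauto

namespace MaxTheory

variable {φ ψ : Form Atm₀ Val}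

theorem mem_of_provable (w : MaxTheory Atm₀ Val) (h : Provable φ) : φ ∈ w :=
  w.closed _ (.thm h)

theorem isBoolean (w : MaxTheory Atm₀ Val) : IsBoolean (· ∈ w) where
  neg := w.neg_mem
  and φ ψ := by
    refine ⟨fun h => ⟨w.closed _ ?_, w.closed _ ?_⟩, fun h => w.closed _ ?_⟩
    · exact (Derivable.hyp h).of_boolean fun val hv h => ((hv.and _ _).1 h).1
    · exact (Derivable.hyp h).of_boolean fun val hv h => ((hv.and _ _).1 h).2
    · exact (Derivable.hyp h.1).of_boolean₂ (.hyp h.2) fun val hv h₁ h₂ => (hv.and _ _).2 ⟨h₁, h₂⟩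

theorem mem_of_imp {w : MaxTheory Atm₀ Val} (h : Provable (.imp φ ψ)) (hφ : φ ∈ w) : ψ ∈ w :=
  (w.isBoolean.imp _ _).1 (w.mem_of_provable h) hφ

/-- The formulas that are necessary, in the dimension `m`, according to `w`. -/
def necessary (m : Dim) (w : MaxTheory Atm₀ Val) : Set (Form Atm₀ Val) :=
  {φ | .box m φ ∈ w}

theorem necessary_closed (m : Dim) (w : MaxTheory Atm₀ Val) (φ : Form Atm₀ Val)
    (h : Derivable (w.necessary m) φ) : φ ∈ w.necessary m := by
  induction h with
  | thm h => exact w.mem_of_provable (.nec m h)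
  | hyp h => exact h
  | mp _ _ ih₁ ih₂ =>
    exact mem_of_imp (.static (.K m _ _)) ((w.isBoolean.and _ _).2 ⟨ih₂, ih₁⟩)

/-- The canonical accessibility relation of the dimension `m`. -/
def Acc (m : Dim) (w v : MaxTheory Atm₀ Val) : Prop := ∀ φ, .box m φ ∈ w → φ ∈ v

namespace Acc

variable {m : Dim} {u v w : MaxTheory Atm₀ Val}

theorem refl (m : Dim) (w : MaxTheory Atm₀ Val) : Acc m w w :=
  fun φ => mem_of_imp (.static (.T m φ))

theorem trans (h₁ : Acc m u v) (h₂ : Acc m v w) : Acc m u w :=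
  fun φ h => h₂ φ (h₁ _ (mem_of_imp (.static (.four m φ)) h))

theorem symm (h : Acc m u v) : Acc m v u := by
  intro φ hv
  by_contra hu
  have h₁ : Form.neg (.box m φ) ∈ u :=
    (u.neg_mem _).2 fun h' => hu (refl m u φ h')
  exact (v.neg_mem _).1 (h _ (mem_of_imp (.static (.five m φ)) h₁)) hv

/-- The required `x` extends what `w` makes F-necessary and `v` makes I-necessary. Were these
jointly inconsistent, some `β` I-necessary at `v` would be F-necessarily false at `w`; the
commutation axiom would then carry `¬□_I β` to `v`. -/
theorem commute (h₁ : Acc .I w u) (h₂ : Acc .F u v) : ∃ x, Acc .F w x ∧ Acc .I x v := by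
  rcases isEmpty_or_nonempty (Form Atm₀ Val) with _ | ⟨⟨χ⟩⟩
  · exact ⟨w, refl _ _, fun φ => isEmptyElim φ⟩
  have hd : ¬ Derivable (w.necessary .F ∪ v.necessary .I) (.falsum χ) := by
    intro h
    obtain ⟨β, hβ, hd⟩ := h.exists_of_union (necessary_closed _ _)
    have hneg : Form.neg β ∈ w.necessary .F := by
      refine necessary_closed _ _ _ (hd.of_boolean fun val hv h => ?_)
      rw [hv.imp] at h
      exact (hv.neg _).2 fun hβ => hv.not_falsum χ (h hβ)
    -- The symmetry axiom for `□_I`, from T and 5, placed under `□_F`.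
    have hT : Form.imp (.neg β) (.box .I (.neg (.box .I β))) ∈ w.necessary .F := by
      refine necessary_closed _ _ _ (.of_boolean₂ (.thm (.static (.T .I β)))
        (.thm (.static (.five .I β))) fun val hv => ?_)
      simp only [hv.imp, hv.neg]
      tauto
    have hFI : Form.boxF (.boxI (.neg (.boxI β))) ∈ w :=
      necessary_closed _ _ _ (.mp (.hyp hT) (.hyp hneg))
    have hIF : Form.boxI (.boxF (.neg (.boxI β))) ∈ w :=
      ((w.isBoolean.iff _ _).1 (w.mem_of_provable (.static (.comm _)))).1 hFI
    exact (v.neg_mem _).1 (h₂ _ (h₁ _ hIF)) hβ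
  obtain ⟨x, hx, -⟩ := exists_maxTheory hd
  exact ⟨x, fun φ hφ => hx φ (.inl hφ), symm fun φ hφ => hx φ (.inr hφ)⟩

end Acc

theorem exists_acc {m : Dim} {w : MaxTheory Atm₀ Val} (h : .box m φ ∉ w) :
    ∃ v, Acc m w v ∧ φ ∉ v :=
  exists_maxTheory fun hd => h (w.necessary_closed m φ hd)

/-- The connected components of the canonical model. -/
def Linked (w v : MaxTheory Atm₀ Val) : Prop := ∃ x, Acc .F w x ∧ Acc .I x v

namespace Linked

variable {u v w : MaxTheory Atm₀ Val}

theorem of_acc {m : Dim} (h : Acc m w v) : Linked w v := by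
  cases m with
  | I => exact ⟨w, .refl _ _, h⟩
  | F => exact ⟨v, h, .refl _ _⟩

theorem symm (h : Linked w v) : Linked v w := by
  obtain ⟨x, h₁, h₂⟩ := h
  exact h₂.symm.commute h₁.symm

theorem trans (h₁ : Linked u v) (h₂ : Linked v w) : Linked u w := by
  obtain ⟨x, hx, hx'⟩ := h₁
  obtain ⟨y, hy, hy'⟩ := h₂
  obtain ⟨z, hz, hz'⟩ := hx'.commute hy
  exact ⟨z, hx.trans hz, hz'.trans hy'⟩

end Linked

/-- The input instance described by a maximal theory. -/
def atoms (w : MaxTheory Atm₀ Val) : Set Atm₀ := {p | .atom p ∈ w}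

theorem atoms_eq_of_acc {w v : MaxTheory Atm₀ Val} (h : Acc .F w v) : v.atoms = w.atoms := by
  ext p
  refine ⟨fun hv => by_contra fun hw => ?_, fun hw => ?_⟩
  · exact (v.neg_mem _).1
      (h _ (mem_of_imp (.static (.indepNeg p)) ((w.neg_mem _).2 hw))) hv
  · exact h _ (mem_of_imp (.static (.indepPos p)) hw)

/-- As there are finitely many atoms, a single formula `c_X` describes the whole input of `w`, and
the functionality axiom applies to it. -/
theorem dec_mem_of_acc {w v : MaxTheory Atm₀ Val} {x : Val} (h : Acc .I w v)
    (hatoms : w.atoms = v.atoms) (hx : .dec x ∈ w) : .dec x ∈ v := by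
  classical
  let X : Finset Atm₀ := Finset.univ.filter (· ∈ w.atoms)
  have hw : Form.conj (.dec x) X Finset.univ ∈ w :=
    (w.isBoolean.conj _ _).2 fun p => by rw [Finset.mem_filter_univ]; exact Iff.rfl
  have hv : Form.conj (.dec x) X Finset.univ ∈ v :=
    (v.isBoolean.conj _ _).2 fun p => by rw [Finset.mem_filter_univ, hatoms]; exact Iff.rfl
  have := h _ (mem_of_imp (.static (.funct (.dec x) X x)) ((w.isBoolean.and _ _).2 ⟨hw, hx⟩))
  exact (v.isBoolean.imp _ _).1 this hv

theorem exists_dec_mem (χ : Form Atm₀ Val) (w : MaxTheory Atm₀ Val) : ∃ x, .dec x ∈ w := by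
  have h := (w.isBoolean.bigOr χ _).1 (w.mem_of_provable (.static (.atLeast χ)))
  simpa using h

theorem dec_unique {w : MaxTheory Atm₀ Val} {x y : Val} (hx : .dec x ∈ w) (hy : .dec y ∈ w) :
    x = y :=
  by_contra fun h => (w.neg_mem _).1 (mem_of_imp (.static (.atMost x y h)) hx) hy

end MaxTheory

end Theories

/-! ### Canonical model and static completeness -/

section Canonical

open MaxTheory

variable {Atm₀ : Type*} {Val : Type*} [Fintype Atm₀] [Fintype Val]

/-- The input instances of the component of `w₀`. -/
def canonicalInputs (w₀ : MaxTheory Atm₀ Val) : Set (Set Atm₀) :=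
  {s | ∃ w, Linked w₀ w ∧ w.atoms = s}

/-- The input instance of a theory in the component of `w₀`. -/
def canonicalPoint {w₀ w : MaxTheory Atm₀ Val} (h : Linked w₀ w) : canonicalInputs w₀ :=
  ⟨w.atoms, w, h, rfl⟩

/-- The classifier `f` agrees with the decisions made in the input dimension around `w`. -/
def Represents {w₀ : MaxTheory Atm₀ Val} (f : canonicalInputs w₀ → Val)
    (w : MaxTheory Atm₀ Val) : Prop :=
  ∀ v (h : Linked w₀ v), Acc .I w v → .dec (f (canonicalPoint h)) ∈ v

/-- The multi-classifier model given by the component of `w₀`. -/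
def canonicalModel (w₀ : MaxTheory Atm₀ Val) : MCM Atm₀ Val where
  S := canonicalInputs w₀
  Φ := {f | ∃ w, Linked w₀ w ∧ Represents f w}

variable {w₀ w v : MaxTheory Atm₀ Val}

theorem Represents.of_acc {f : canonicalInputs w₀ → Val} (hf : Represents f w)
    (h : Acc .I w v) : Represents f v :=
  fun u hu hvu => hf u hu (h.trans hvu)

/-- Every I-class of the component meets every F-class, and an F-class has constant atoms. -/
theorem exists_acc_atoms_eq (hw : Linked w₀ w) (s : canonicalInputs w₀) :
    ∃ v, Acc .I w v ∧ Linked w₀ v ∧ v.atoms = s.1 := by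
  obtain ⟨s, u, hu, rfl⟩ := s
  obtain ⟨x, hx, hx'⟩ := (hu.symm.trans hw)
  exact ⟨x, hx'.symm, hw.trans (.of_acc hx'.symm), atoms_eq_of_acc hx⟩

/-- Choose a theory of the I-class at each input and read off its decision; functionality makes the
choice irrelevant. -/
theorem exists_represents (χ : Form Atm₀ Val) (hw : Linked w₀ w) :
    ∃ f : canonicalInputs w₀ → Val, Represents f w := by
  choose v hv _ hatoms using exists_acc_atoms_eq hw
  choose d hd using exists_dec_mem (Atm₀ := Atm₀) (Val := Val) χ
  exact ⟨fun s => d (v s), fun u hu hwu =>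
    dec_mem_of_acc ((hv _).symm.trans hwu) (hatoms (canonicalPoint hu)) (hd _)⟩

theorem IsStatic.sat_canonical {φ : Form Atm₀ Val} (hφ : IsStatic φ)
    (hw : Linked w₀ w) {f : canonicalInputs w₀ → Val} (hf : Represents f w) :
    Sat φ (canonicalModel w₀) (canonicalPoint hw) f ↔ φ ∈ w := by
  induction hφ generalizing w f with
  | atom p => exact Iff.rfl
  | dec x =>
    have h := hf w hw (.refl _ _)
    refine ⟨fun hx => ?_, fun hx => dec_unique h hx⟩
    have hx : f (canonicalPoint hw) = x := hx
    exact hx ▸ h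
  | neg _ ih => exact (not_congr (ih hw hf)).trans (w.isBoolean.neg _).symm
  | and _ _ ih₁ ih₂ =>
    exact (and_congr (ih₁ hw hf) (ih₂ hw hf)).trans (w.isBoolean.and _ _).symm
  | @boxI φ _ ih =>
    constructor
    · intro h
      by_contra hbox
      obtain ⟨v, hv, hφ⟩ := exists_acc (m := .I) hbox
      have hv₀ := hw.trans (.of_acc hv)
      exact hφ ((ih hv₀ (hf.of_acc hv)).1 (h (canonicalPoint hv₀)))
    · intro h s
      obtain ⟨v, hv, hv₀, hs⟩ := exists_acc_atoms_eq hw s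
      have : canonicalPoint hv₀ = s := Subtype.ext hs
      exact this ▸ (ih hv₀ (hf.of_acc hv)).2 (hv φ h)
  | @boxF φ _ ih =>
    have point : ∀ {v} (_ : Acc .F w v) (hv₀ : Linked w₀ v),
        canonicalPoint hv₀ = canonicalPoint hw := fun hv _ => Subtype.ext (atoms_eq_of_acc hv)
    constructor
    · intro h
      by_contra hbox
      obtain ⟨v, hv, hφ⟩ := exists_acc (m := .F) hbox
      have hv₀ := hw.trans (.of_acc hv)
      obtain ⟨g, hg⟩ := exists_represents φ hv₀
      have := h g ⟨v, hv₀, hg⟩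
      rw [← point hv hv₀] at this
      exact hφ ((ih hv₀ hg).1 this)
    · rintro h g ⟨u, hu, hg⟩
      -- The theory `v` has the input of `w` and lies in the I-class of `u`, so `g` represents it.
      obtain ⟨v, hv, hvu⟩ := hw.symm.trans hu
      have hv₀ := hw.trans (.of_acc hv)
      rw [← point hv hv₀]
      exact (ih hv₀ (hg.of_acc hvu.symm)).2 (hv φ h)

theorem IsStatic.provable {φ : Form Atm₀ Val} (hφ : IsStatic φ) (h : Valid φ) :
    Provable φ := by
  by_contra hn
  obtain ⟨w, -, hw⟩ := exists_maxTheory (A := ∅) (φ := φ) fun hd => hn hd.provable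
  have hlink : Linked w w := .of_acc (.refl .I w)
  obtain ⟨f, hf⟩ := exists_represents φ hlink
  exact hw ((hφ.sat_canonical hlink hf).1
    ((valid_iff φ).1 h (canonicalModel w) _ f ⟨w, hlink, hf⟩))

end Canonical

/-! ### Elimination of updates -/

section Reduction

variable {Atm₀ : Type*} {Val : Type*} [Fintype Atm₀] [Fintype Val]

theorem Provable.iff_refl (φ : Form Atm₀ Val) : Provable (.iff φ φ) :=
  .of_boolean fun _ hv => (hv.iff _ _).2 Iff.rfl

theorem Provable.iff_trans {φ ψ χ : Form Atm₀ Val} (h₁ : Provable (.iff φ ψ))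
    (h₂ : Provable (.iff ψ χ)) : Provable (.iff φ χ) :=
  (Derivable.of_boolean₂ (A := ∅) (.thm h₁) (.thm h₂) fun _ hv h₁ h₂ =>
    (hv.iff _ _).2 (((hv.iff _ _).1 h₁).trans ((hv.iff _ _).1 h₂))).provable

/-- With both arguments static, no axiom for nested updates is needed: the reduction axioms move the
update down to atoms and decisions. -/
theorem IsStatic.exists_iff_upd {φ ψ : Form Atm₀ Val} (hφ : IsStatic φ) (hψ : IsStatic ψ) :
    ∃ χ, IsStatic χ ∧ Provable (.iff (.upd φ ψ) χ) := by
  induction hψ with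
  | atom p => exact ⟨_, hφ.boxI.imp (.atom p), .reduction (.atom φ p)⟩
  | dec x => exact ⟨_, hφ.boxI.imp (.dec x), .reduction (.dec φ x)⟩
  | neg _ ih =>
    obtain ⟨χ, hχ, h⟩ := ih
    exact ⟨_, hφ.boxI.imp hχ.neg, (Provable.reduction (.neg φ _)).iff_trans
      -- Implication abbreviates `¬(_ ∧ ¬_)`, so the path to the replaced occurrence runs through
      -- these connectives.
      (.re h (.neg (.and (.refl _) (.neg (.neg .here)))))⟩
  | and _ _ ih₁ ih₂ =>
    obtain ⟨χ₁, hχ₁, h₁⟩ := ih₁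
    obtain ⟨χ₂, hχ₂, h₂⟩ := ih₂
    exact ⟨_, hχ₁.and hχ₂, ((Provable.reduction (.and φ _ _)).iff_trans
      (.re h₁ (.and .here (.refl _)))).iff_trans (.re h₂ (.and (.refl _) .here))⟩
  | boxI _ ih =>
    obtain ⟨χ, hχ, h⟩ := ih
    exact ⟨_, hφ.boxI.imp hχ.boxI, (Provable.reduction (.boxI φ _)).iff_trans
      (.re h (.neg (.and (.refl _) (.neg (.boxI .here)))))⟩
  | boxF _ ih =>
    obtain ⟨χ, hχ, h⟩ := ih
    exact ⟨_, hφ.boxI.imp hχ.boxF, (Provable.reduction (.boxF φ _)).iff_trans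
      (.re h (.neg (.and (.refl _) (.neg (.boxF .here)))))⟩

theorem exists_isStatic_iff (φ : Form Atm₀ Val) : ∃ χ, IsStatic χ ∧ Provable (.iff φ χ) := by
  induction φ with
  | atom p => exact ⟨_, .atom p, .iff_refl _⟩
  | dec x => exact ⟨_, .dec x, .iff_refl _⟩
  | neg φ ih =>
    obtain ⟨χ, hχ, h⟩ := ih
    exact ⟨_, hχ.neg, .re h (.neg .here)⟩
  | and φ ψ ih₁ ih₂ =>
    obtain ⟨χ₁, hχ₁, h₁⟩ := ih₁
    obtain ⟨χ₂, hχ₂, h₂⟩ := ih₂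
    exact ⟨_, hχ₁.and hχ₂, (Provable.re h₁ (.and .here (.refl _))).iff_trans
      (.re h₂ (.and (.refl _) .here))⟩
  | boxI φ ih =>
    obtain ⟨χ, hχ, h⟩ := ih
    exact ⟨_, hχ.boxI, .re h (.boxI .here)⟩
  | boxF φ ih =>
    obtain ⟨χ, hχ, h⟩ := ih
    exact ⟨_, hχ.boxF, .re h (.boxF .here)⟩
  | upd φ ψ ih₁ ih₂ =>
    obtain ⟨χ₁, hχ₁, h₁⟩ := ih₁
    obtain ⟨χ₂, hχ₂, h₂⟩ := ih₂
    obtain ⟨χ, hχ, h⟩ := hχ₁.exists_iff_upd hχ₂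
    exact ⟨χ, hχ, ((Provable.re h₁ (.upd .here (.refl _))).iff_trans
      (.re h₂ (.upd (.refl _) .here))).iff_trans h⟩

theorem Valid.provable {φ : Form Atm₀ Val} (h : Valid φ) : Provable φ := by
  obtain ⟨χ, hχ, hiff⟩ := exists_isStatic_iff φ
  have hvalid : Valid χ := (valid_iff χ).2 fun Γ s f hf =>
    ((sat_iff _ _ _ _ _).1 ((valid_iff _).1 hiff.valid Γ s f hf)).1 ((valid_iff φ).1 h Γ s f hf)
  exact (Derivable.of_boolean₂ (A := ∅) (.thm hiff) (.thm (hχ.provable hvalid))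
    fun _ hv h₁ => ((hv.iff _ _).1 h₁).2).provable

end Reduction

end DPLC

theorem mainTheorem10 (Atm₀ : Type*) (Val : Type*) [Fintype Atm₀] [Fintype Val] :
    (∀ φ : DPLC.Form Atm₀ Val, DPLC.Provable φ → DPLC.Valid φ) ∧
      (∀ φ : DPLC.Form Atm₀ Val, DPLC.Valid φ → DPLC.Provable φ) :=
  ⟨fun _ => DPLC.Provable.valid, fun _ => DPLC.Valid.provable⟩
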